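/- Let $K\ge 1$ be an integer, let $0\le p_{01}\le p_{11}\le 1$, and let $\lambda\ge 0$. Put $\mathcal T(\omega)=\omega p_{11}+(1-\omega)p_{01}$, $(k)_+=(k \bmod K)+1$ and $(k)_-=((K+k-2)\bmod K)+1$. The belief MDP has the state space $$\mathcal S=\{(\Delta,k,\omega): k\in\{1,\dots,K\},\ \Delta=mK+(k)_-\text{ for some integer } m\ge 0,\ \omega\in\{\mathcal T^i(p_{01}),\mathcal T^i(p_{11}):0\le i<\Delta\}\},$$ where $\Delta$ is the age of information (AoI), $k$ the slot index within a frame and $\omega$ the belief that the channel is good. The actions are $u\in\{0,1\}$ and the one-slot cost is $\Delta+\lambda u$. From $(\Delta,k,\omega)$, action $u=0$ leads to $(\Delta+1,(k)_+,\mathcal T(\omega))$, and action $u=1$ leads to $(k,(k)_+,p_{11})$ with probability $\omega$ and to $(\Delta+1,(k)_+,p_{01})$ with probability $1-\omega$. For $N\ge 0$ let $\nu_N(\Delta,k,\omega)=(\min\{\Delta,N\},k,\varphi_N(\omega))$, where $\varphi_N(\omega)=\mathcal T^N(p_{11})$ if $\mathcal T^N(p_{01})<\omega<\mathcal T^N(p_{11})$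 and $\varphi_N(\omega)=\omega$ otherwise. The approximate MDP with bound $N$ has the finite state space $\mathcal S^N=\nu_N(\mathcal S)$, the same actions and costs, and the same transitions except that every successor state is redirected through $\nu_N$. For each of these MDPs and each initial state $\mathbf s$, let the optimal average Lagrangian cost be $$\inf_\pi\ \limsup_{T\to\infty}\frac1T\,\mathbb E_\pi\Big[\sum_{t=1}^T(\Delta_t+\lambda u_t)\,\Big|\,\mathbf s_1=\mathbf s\Big]\in[0,\infty],$$ the infimum being over all history-dependent randomized policies. Denote it by $\bar L^{*}(\lambda;\mathbf s)$ for the belief MDP and by $\bar L^{N*}(\lambda;\mathbf s)$ for the approximate MDP. Then for every $\mathbf s\in\mathcal S$, $$\bar L^{N*}(\lambda;\nu_N(\mathbf s))\longrightarrow \bar L^{*}(\lambda;\mathbf s)\qquad (N\to\infty),$$ where $\nu_N(\mathbf s)=\mathbf s$ for all sufficiently large $N$. -/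

import Mathlib

open Filter Topology
open scoped NNReal ENNReal

noncomputable section

/-! ### Markov decision processes with the long-run average cost criterion -/

/-- A Markov decision process with states `S` and actions `α`:
`step s a` is the law of the next state, `cost s a` the cost of one slot. -/
structure MDP (S α : Type*) where
  step : S → α → PMF S
  cost : S → α → ℝ≥0∞

namespace MDP

variable {S α : Type*}

/-- A (history dependent, randomized) policy: the past states and actions, in the order of time,
and the current state determine the law of the action. The number of the slot is one more than
the length of the history, so that decision rules may depend on time. -/
def Policy (S α : Type*) : Type _ := List (S × α) → S → PMF α

/-- The joint law, under `π` and from the initial state `s`, of the history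
`[(s₁, u₁), …, (s_T, u_T)]` of the first `T` slots and of the state `s_{T+1}`. -/
def law (M : MDP S α) (π : Policy S α) (s : S) : ℕ → PMF (List (S × α) × S)
  | 0 => PMF.pure ([], s)
  | T + 1 => (law M π s T).bind fun x =>
      (π x.1 x.2).bind fun a =>
        (M.step x.2 a).map fun s' => (x.1 ++ [(x.2, a)], s')

/-- The expected total cost `𝔼_π [∑_{t=1}^T C(s_t, u_t)]` from the initial state `s`. -/
def expectedCost (M : MDP S α) (π : Policy S α) (s : S) (T : ℕ) : ℝ≥0∞ :=
  ∑' x : List (S × α) × S, M.law π s T x * (x.1.map fun y => M.cost y.1 y.2).sum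

/-- The average cost `limsup_{T → ∞} (1/T) 𝔼_π [∑_{t=1}^T C(s_t, u_t)]`. -/
def avgCost (M : MDP S α) (π : Policy S α) (s : S) : ℝ≥0∞ :=
  limsup (fun T : ℕ => M.expectedCost π s T / (T : ℝ≥0∞)) atTop

/-- The optimal average cost from the initial state `s`, over all policies. -/
def optAvgCost (M : MDP S α) (s : S) : ℝ≥0∞ := ⨅ π : Policy S α, M.avgCost π s

end MDP

/-! ### Status updates over a Gilbert-Elliott channel without channel sensing -/

/-- A frame has `K ≥ 1` slots; the channel goes from bad to good with probability `p01` and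
stays good with probability `p11`; it is positively correlated. -/
structure UpdateSystem where
  K : ℕ
  K_pos : 0 < K
  p01 : unitInterval
  p11 : unitInterval
  p01_le_p11 : p01 ≤ p11

namespace UpdateSystem

/-- A triple: age of information, relative slot index, belief that the channel is good. -/
@[ext]
structure State where
  age : ℕ
  slot : ℕ
  belief : unitInterval

variable (M : UpdateSystem)

/-- The next relative slot index `(k mod K) + 1`. -/
def succSlot (k : ℕ) : ℕ := k % M.K + 1

/-- The previous relative slot index `((K + k - 2) mod K) + 1`, for `1 ≤ k`. -/
def predSlot (k : ℕ) : ℕ := (M.K + k - 2) % M.K + 1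

/-- The one-step belief update `ω p11 + (1 - ω) p01`. -/
def beliefStep (ω : unitInterval) : unitInterval :=
  ⟨(ω : ℝ) * M.p11 + (1 - ω) * M.p01, by
    have h1 := mul_nonneg ω.2.1 M.p11.2.1
    have h2 := mul_nonneg (sub_nonneg.2 ω.2.2) M.p01.2.1
    have h3 := mul_nonneg ω.2.1 (sub_nonneg.2 M.p11.2.2)
    have h4 := mul_nonneg (sub_nonneg.2 ω.2.2) (sub_nonneg.2 M.p01.2.2)
    constructor <;> nlinarith⟩

/-- The ages `m K + (k)₋` that are possible in slot `k` of a frame. -/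
def ages (k : ℕ) : Set ℕ := {Δ | ∃ m : ℕ, Δ = m * M.K + M.predSlot k}

/-- The beliefs that are possible with age `Δ`. -/
def beliefs (Δ : ℕ) : Set unitInterval :=
  {ω | ∃ m < Δ, ω = M.beliefStep^[m] M.p01 ∨ ω = M.beliefStep^[m] M.p11}

/-- The state space of the belief MDP. -/
def stateSpace : Set State :=
  {s | 1 ≤ s.slot ∧ s.slot ≤ M.K ∧ s.age ∈ M.ages s.slot ∧ s.belief ∈ M.beliefs s.age}

/-- The law of the observation (`true` for an acknowledged transmission) in state `s` under the
action `u` (`true` for transmission). -/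
def obs (s : State) (u : Bool) : PMF Bool :=
  if u then
    PMF.ofFintype (fun θ => ENNReal.ofReal (if θ then (s.belief : ℝ) else 1 - s.belief)) (by
      rw [Fintype.sum_bool, if_pos rfl, if_neg Bool.false_ne_true,
        ← ENNReal.ofReal_add s.belief.2.1 (sub_nonneg.2 s.belief.2.2)]
      simp)
  else PMF.pure false

/-- The next state, given the state `s`, the action `u` and the observation `θ`. -/
def next (s : State) (u θ : Bool) : State where
  age := if u ∧ θ then s.slot else s.age + 1
  slot := M.succSlot s.slot
  belief := if u then (if θ then M.p11 else M.p01) else M.beliefStep s.belief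

/-- The Lagrangian cost of a slot: the age, and the multiplier `lam` for a transmission. -/
def lagrangianCost (lam : ℝ≥0) (s : State) (u : Bool) : ℝ≥0∞ :=
  (s.age : ℝ≥0∞) + (lam : ℝ≥0∞) * (if u then 1 else 0)

lemma predSlot_succSlot {k : ℕ} (h1 : 1 ≤ k) (hk : k ≤ M.K) :
    M.predSlot (M.succSlot k) = k := by
  unfold predSlot succSlot
  rcases hk.lt_or_eq with h | h
  · rw [Nat.mod_eq_of_lt h, show M.K + (k + 1) - 2 = (k - 1) + M.K by omega,
      Nat.add_mod_right, Nat.mod_eq_of_lt (by omega)]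
    omega
  · rw [h, Nat.mod_self, Nat.mod_eq_of_lt (by omega)]
    omega

lemma age_succ_mem {k Δ : ℕ} (h1 : 1 ≤ k) (hk : k ≤ M.K) (h : Δ ∈ M.ages k) :
    Δ + 1 ∈ M.ages (M.succSlot k) := by
  obtain ⟨m, rfl⟩ := h
  unfold ages
  simp only [Set.mem_ofPred_eq, M.predSlot_succSlot h1 hk]
  unfold predSlot
  rcases h1.lt_or_eq with h | h
  · refine ⟨m, ?_⟩
    rw [show M.K + k - 2 = (k - 2) + M.K by omega, Nat.add_mod_right,
      Nat.mod_eq_of_lt (by omega)]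
    omega
  · subst h
    refine ⟨m + 1, ?_⟩
    rw [Nat.mod_eq_of_lt (by omega), add_mul]
    omega

lemma next_mem {s : State} (hs : s ∈ M.stateSpace) (u θ : Bool) :
    M.next s u θ ∈ M.stateSpace := by
  obtain ⟨h1, hk, ha, m, hm, hb⟩ := hs
  refine ⟨by simp [next, succSlot], Nat.mod_lt _ M.K_pos, ?_, ?_⟩
  · by_cases h : u ∧ θ
    · simp only [next, h, and_self, if_true]
      exact ⟨0, by simp [M.predSlot_succSlot h1 hk]⟩
    · simp only [next, h, if_false]
      exact M.age_succ_mem h1 hk ha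
  · cases u
    · refine ⟨m + 1, by simpa [next] using hm, ?_⟩
      simp only [next, Function.iterate_succ_apply']
      rcases hb with hb | hb <;> simp [hb]
    · cases θ
      · exact ⟨0, by simp [next], Or.inl rfl⟩
      · exact ⟨0, by simp only [next]; simpa using Nat.lt_of_succ_le h1, Or.inr rfl⟩

/-- The belief MDP, with the Lagrangian cost for the multiplier `lam`. -/
def beliefMDP (lam : ℝ≥0) : MDP M.stateSpace Bool where
  step s u := (obs s u).map fun θ => ⟨M.next s u θ, M.next_mem s.2 u θ⟩
  cost s u := lagrangianCost lam s u

/-! ### The finite-state approximation -/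

/-- The redirection of beliefs for the bound `N`. -/
def clipBelief (N : ℕ) (ω : unitInterval) : unitInterval :=
  if M.beliefStep^[N] M.p01 < ω ∧ ω < M.beliefStep^[N] M.p11
  then M.beliefStep^[N] M.p11 else ω

/-- The approximation map `ν` for the bound `N`. -/
def nu (N : ℕ) (s : State) : State where
  age := min s.age N
  slot := s.slot
  belief := M.clipBelief N s.belief

/-- The state space of the approximation: the states of the belief MDP, redirected by `ν`.
It contains every state of the belief MDP with age at most `N` and belief outside the redirected
interval (`ν` fixes them), and the images of the overflow states. -/
def approxStateSpace (N : ℕ) : Set State := M.nu N '' M.stateSpace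

lemma beliefStep_mono : Monotone M.beliefStep := by
  intro a b hab
  have h1 : (a : ℝ) ≤ b := hab
  have h2 : (M.p01 : ℝ) ≤ M.p11 := M.p01_le_p11
  change (a : ℝ) * M.p11 + (1 - a) * M.p01 ≤ (b : ℝ) * M.p11 + (1 - b) * M.p01
  nlinarith [mul_nonneg (sub_nonneg.2 h1) (sub_nonneg.2 h2)]

lemma p01_le_beliefStep (ω : unitInterval) : M.p01 ≤ M.beliefStep ω := by
  have h2 : (M.p01 : ℝ) ≤ M.p11 := M.p01_le_p11
  change (M.p01 : ℝ) ≤ (ω : ℝ) * M.p11 + (1 - ω) * M.p01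
  nlinarith [mul_nonneg ω.2.1 (sub_nonneg.2 h2)]

lemma beliefStep_le_p11 (ω : unitInterval) : M.beliefStep ω ≤ M.p11 := by
  have h2 : (M.p01 : ℝ) ≤ M.p11 := M.p01_le_p11
  change (ω : ℝ) * M.p11 + (1 - ω) * M.p01 ≤ (M.p11 : ℝ)
  nlinarith [mul_nonneg (sub_nonneg.2 ω.2.2) (sub_nonneg.2 h2)]

lemma nu_next_mem (N : ℕ) {s : State} (hs : s ∈ M.approxStateSpace N) (u θ : Bool) :
    M.nu N (M.next s u θ) ∈ M.approxStateSpace N := by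
  obtain ⟨r, hr, rfl⟩ := hs
  by_cases hc : u = false ∧ M.clipBelief N r.belief ≠ r.belief
  · obtain ⟨rfl, hc⟩ := hc
    have hlt : M.beliefStep^[N] M.p01 < r.belief ∧ r.belief < M.beliefStep^[N] M.p11 := by
      by_contra h
      exact hc (by simp [clipBelief, h])
    obtain ⟨h1, hk, ha, m, hm, hb⟩ := hr
    have hNm : N < m := by
      by_contra h
      have hmN : m ≤ N := not_lt.1 h
      rcases hb with hb | hb
      · have := M.beliefStep_mono.monotone_iterate_of_le_map (M.p01_le_beliefStep _) hmN
        exact absurd hlt.1 (not_lt.2 (hb ▸ this))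
      · have := M.beliefStep_mono.antitone_iterate_of_map_le (M.beliefStep_le_p11 _) hmN
        exact absurd hlt.2 (not_lt.2 (hb ▸ this))
    refine ⟨⟨r.age + 1, M.succSlot r.slot, M.beliefStep^[N + 1] M.p11⟩,
      ⟨by simp [succSlot], Nat.mod_lt _ M.K_pos, M.age_succ_mem h1 hk ha,
        N + 1, by change N + 1 < r.age + 1; omega, Or.inr rfl⟩, ?_⟩
    ext
    · simp only [nu, next]; simp; omega
    · rfl
    · simp [nu, next, clipBelief, hlt, Function.iterate_succ_apply']
  · refine ⟨M.next r u θ, M.next_mem hr u θ, ?_⟩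
    ext
    · simp only [nu, next]; split_ifs <;> omega
    · rfl
    · cases u
      · have : M.clipBelief N r.belief = r.belief := by simpa using hc
        simp [nu, next, this]
      · simp [nu, next]

/-- The approximate MDP for the bound `N`: the transitions of the belief MDP, redirected by `ν`. -/
def approxMDP (N : ℕ) (lam : ℝ≥0) : MDP (M.approxStateSpace N) Bool where
  step s u := (obs s u).map fun θ => ⟨M.nu N (M.next s u θ), M.nu_next_mem N s.2 u θ⟩
  cost s u := lagrangianCost lam s u

/-- The state of the approximation that represents the state `s` of the belief MDP; it is `s`
itself once `N` is large. -/
def toApprox (N : ℕ) (s : M.stateSpace) : M.approxStateSpace N :=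
  ⟨M.nu N s, s, s.2, rfl⟩

end UpdateSystem

end

/-! The redirection `nu N` only improves a state: it lowers the age and raises the belief. Optimal
discounted costs are monotone in age and belief (`value_mono`), so those of the approximation lie
below those of the belief MDP (`value_le_value`). The rest is a double limit in the compact space
[0,∞], where ultrafilter limits exist with no boundedness needed.

Discount limit, for a fixed redirection: subtract from the discounted value its minimum `m`,
attained just after a delivery. If transmissions keep a success probability of at least `δ`, waiting
for the right slot and transmitting once per frame bounds the difference by `waitBound`, uniformly
in discount and redirection (`exists_relative_value`). As the discount vanishes, `γ * m` tends to a
gain `g` and the differences to a solution of the average cost optimality inequality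
(`exists_gain`). That inequality makes `g` an upper bound for the optimal cost; an Abelian estimate
makes it a lower bound, both for this MDP and for the belief MDP.

Limit in `N`: every fixed successor state is eventually fixed by `nu N`, so the limits of gains and
relative values solve the inequality of the belief MDP. Its cost is then at most the limit of the
gains, which never exceed it.

If no such `δ` exists at the initial state, the channel is doomed: potentials that reward age up to
a level `G` show that the cost of the belief MDP is infinite and that of the approximations
diverges. -/

noncomputable section

/-! ### Expectations of [0,∞]-valued functions -/

namespace PMF

variable {β γ : Type*}

/-- The expectation of a nonnegative function. -/
def expect (p : PMF β) (f : β → ℝ≥0∞) : ℝ≥0∞ := ∑' x, p x * f x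

lemma expect_pure (a : β) (f : β → ℝ≥0∞) : (PMF.pure a).expect f = f a := by
  unfold expect
  rw [tsum_eq_single a]
  · simp
  · intro b hb
    simp [PMF.pure_apply, hb]

lemma expect_bind (p : PMF β) (k : β → PMF γ) (f : γ → ℝ≥0∞) :
    (p.bind k).expect f = p.expect fun x => (k x).expect f := by
  unfold expect
  simp only [PMF.bind_apply, ← ENNReal.tsum_mul_right, ← ENNReal.tsum_mul_left]
  rw [ENNReal.tsum_comm]
  simp only [mul_assoc]

lemma expect_map (p : PMF β) (k : β → γ) (f : γ → ℝ≥0∞) :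
    (p.map k).expect f = p.expect fun x => f (k x) := by
  unfold PMF.map
  rw [expect_bind]
  simp [expect_pure]

lemma expect_add (p : PMF β) (f g : β → ℝ≥0∞) :
    p.expect (fun x => f x + g x) = p.expect f + p.expect g := by
  simp [expect, mul_add, ENNReal.tsum_add]

lemma expect_const (p : PMF β) (c : ℝ≥0∞) : p.expect (fun _ => c) = c := by
  simp [expect, ENNReal.tsum_mul_right, p.tsum_coe]

lemma expect_const_mul (p : PMF β) (c : ℝ≥0∞) (f : β → ℝ≥0∞) :
    p.expect (fun x => c * f x) = c * p.expect f := by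
  simp [expect, ← ENNReal.tsum_mul_left, mul_left_comm]

lemma expect_mono (p : PMF β) {f g : β → ℝ≥0∞} (h : ∀ x, f x ≤ g x) :
    p.expect f ≤ p.expect g :=
  ENNReal.tsum_le_tsum fun x => mul_le_mul_right (h x) _

end PMF

/-! ### Bounds on average and discounted costs in a general MDP -/

namespace MDP

variable {S α : Type*} (M : MDP S α)

/-- The expected cost of the slot `t + 1`. -/
def slotCost (π : Policy S α) (s : S) (t : ℕ) : ℝ≥0∞ :=
  (M.law π s t).expect fun x => (π x.1 x.2).expect fun a => M.cost x.2 a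

lemma expect_law_succ (π : Policy S α) (s : S) (t : ℕ) (F : List (S × α) × S → ℝ≥0∞) :
    (M.law π s (t + 1)).expect F = (M.law π s t).expect fun x => (π x.1 x.2).expect fun a =>
      (M.step x.2 a).expect fun s' => F (x.1 ++ [(x.2, a)], s') := by
  simp only [law, PMF.expect_bind, PMF.expect_map]

lemma expectedCost_zero (π : Policy S α) (s : S) : M.expectedCost π s 0 = 0 := by
  have : M.expectedCost π s 0 = (M.law π s 0).expect
      fun x => (x.1.map fun y => M.cost y.1 y.2).sum := rfl
  rw [this]
  simp [law, PMF.expect_pure]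

lemma expectedCost_succ (π : Policy S α) (s : S) (t : ℕ) :
    M.expectedCost π s (t + 1) = M.expectedCost π s t + M.slotCost π s t := by
  have h : ∀ t, M.expectedCost π s t = (M.law π s t).expect
      fun x => (x.1.map fun y => M.cost y.1 y.2).sum := fun _ => rfl
  rw [h, h, expect_law_succ, slotCost, ← PMF.expect_add]
  simp [PMF.expect_const, PMF.expect_add]

lemma expectedCost_eq_sum (π : Policy S α) (s : S) (T : ℕ) :
    M.expectedCost π s T = ∑ t ∈ Finset.range T, M.slotCost π s t := by
  induction T with
  | zero => simp [expectedCost_zero]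
  | succ T ih => rw [expectedCost_succ, ih, Finset.sum_range_succ]

/-- The stationary deterministic policy of a decision rule. -/
def stationary (f : S → α) : Policy S α := fun _ s => PMF.pure (f s)

/-- The optimality inequality bounds the average cost of a stationary policy from above. -/
lemma optAvgCost_le_of_optimality_ineq (f : S → α) {g : ℝ≥0∞} {h : S → ℝ≥0∞}
    (H : ∀ s, M.cost s (f s) + (M.step s (f s)).expect h ≤ g + h s) {s : S} (hs : h s ≠ ∞) :
    M.optAvgCost s ≤ g := by
  -- The inequality telescopes with `h` as terminal cost. Only `h s` at the initial state must be
  -- finite; `h` may be infinite elsewhere.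
  have key : ∀ T : ℕ, M.expectedCost (stationary f) s T
      + (M.law (stationary f) s T).expect (fun x => h x.2) ≤ T * g + h s := by
    intro T
    induction T with
    | zero => simp [expectedCost_zero, law, PMF.expect_pure]
    | succ T ih =>
      rw [expectedCost_succ, expect_law_succ, add_assoc, slotCost, ← PMF.expect_add]
      simp only [stationary, PMF.expect_pure]
      calc _ ≤ M.expectedCost (stationary f) s T
            + (M.law (stationary f) s T).expect (fun x => g + h x.2) := by
              gcongr
              exact PMF.expect_mono _ fun x => H x.2
        _ = g + (M.expectedCost (stationary f) s T
            + (M.law (stationary f) s T).expect (fun x => h x.2)) := by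
              rw [PMF.expect_add, PMF.expect_const]; ring
        _ ≤ g + (T * g + h s) := by gcongr
        _ = _ := by push_cast; ring
  refine (iInf_le _ (stationary f)).trans ?_
  have hlim : Tendsto (fun T : ℕ => g + h s / (T : ℝ≥0∞)) atTop (𝓝 (g + 0)) :=
    tendsto_const_nhds.add (by
      simpa using ENNReal.Tendsto.const_div ENNReal.tendsto_nat_nhds_top (Or.inr hs))
  rw [add_zero] at hlim
  rw [avgCost, ← hlim.limsup_eq]
  refine limsup_le_limsup ?_
  filter_upwards [eventually_gt_atTop 0] with T hT
  have hT0 : (T : ℝ≥0∞) ≠ 0 := by exact_mod_cast hT.ne'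
  rw [ENNReal.div_le_iff hT0 (ENNReal.natCast_ne_top T), add_mul,
    ENNReal.div_mul_cancel hT0 (ENNReal.natCast_ne_top T), mul_comm g]
  exact le_self_add.trans (key T)

/-- A bounded potential and a subharmonic gain bound the average cost from below. -/
lemma le_optAvgCost_of_potential {g φ : S → ℝ≥0∞} {B : ℝ≥0∞} (hB : B ≠ ∞) (hφ : ∀ s, φ s ≤ B)
    (hg : ∀ s a, g s ≤ (M.step s a).expect g)
    (H : ∀ s a, g s + φ s ≤ M.cost s a + (M.step s a).expect φ) (s : S) :
    g s ≤ M.optAvgCost s := by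
  refine le_iInf fun π => ?_
  have hsub : ∀ T : ℕ, g s ≤ (M.law π s T).expect (fun x => g x.2) := by
    intro T
    induction T with
    | zero => simp [law, PMF.expect_pure]
    | succ T ih =>
      refine ih.trans ?_
      rw [expect_law_succ]
      refine PMF.expect_mono _ fun x => ?_
      rw [← PMF.expect_const (π x.1 x.2) (g x.2)]
      exact PMF.expect_mono _ fun a => hg _ _
  have key : ∀ T : ℕ, T * g s + φ s ≤ M.expectedCost π s T
      + (M.law π s T).expect (fun x => φ x.2) := by
    intro T
    induction T with
    | zero => simp [expectedCost_zero, law, PMF.expect_pure]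
    | succ T ih =>
      rw [expectedCost_succ, expect_law_succ, add_assoc, slotCost, ← PMF.expect_add]
      calc ((T + 1 : ℕ) : ℝ≥0∞) * g s + φ s = T * g s + φ s + g s := by push_cast; ring
        _ ≤ M.expectedCost π s T + (M.law π s T).expect (fun x => φ x.2)
            + (M.law π s T).expect (fun x => g x.2) := by gcongr; exact hsub T
        _ = M.expectedCost π s T + (M.law π s T).expect (fun x => g x.2 + φ x.2) := by
            rw [PMF.expect_add]; ring
        _ ≤ _ := by
            gcongr
            refine PMF.expect_mono _ fun x => ?_
            rw [← PMF.expect_add, ← PMF.expect_const (π x.1 x.2) (g x.2 + φ x.2)]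
            exact PMF.expect_mono _ fun a => H _ _
  have hlim : Tendsto (fun T : ℕ => B / (T : ℝ≥0∞)) atTop (𝓝 0) := by
    simpa using ENNReal.Tendsto.const_div ENNReal.tendsto_nat_nhds_top (Or.inr hB)
  have hle : ∀ᶠ T : ℕ in atTop, g s ≤ M.expectedCost π s T / T + B / T := by
    filter_upwards [eventually_gt_atTop 0] with T hT
    have hT0 : (T : ℝ≥0∞) ≠ 0 := by exact_mod_cast hT.ne'
    rw [← ENNReal.add_div, ENNReal.le_div_iff_mul_le (Or.inl hT0)
      (Or.inl (ENNReal.natCast_ne_top T)), mul_comm]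
    refine le_self_add.trans ((key T).trans ?_)
    gcongr
    rw [← PMF.expect_const (M.law π s T) B]
    exact PMF.expect_mono _ fun x => hφ _
  rw [avgCost]
  refine ENNReal.le_of_forall_pos_le_add fun ε hε _ => ?_
  have h2 : ∀ᶠ T : ℕ in atTop, g s - ε ≤ M.expectedCost π s T / T := by
    filter_upwards [hle, hlim.eventually (ge_mem_nhds (ENNReal.coe_pos.2 hε))] with T h1 h2
    rw [tsub_le_iff_right]
    exact h1.trans (by gcongr)
  rw [← tsub_le_iff_right]
  exact le_limsup_of_frequently_le h2.frequently

/-- Discounted value iterates are bounded by the discounted cost of every policy. -/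
lemma iterate_le_discounted_cost {v : ℕ → S → ℝ≥0∞} {β : ℝ≥0∞} (h0 : ∀ s, v 0 s = 0)
    (hv : ∀ n s a, v (n + 1) s ≤ M.cost s a + β * (M.step s a).expect (v n))
    (π : Policy S α) (s : S) (n : ℕ) :
    v n s ≤ ∑ t ∈ Finset.range n, β ^ t * M.slotCost π s t := by
  have key : ∀ n t, (M.law π s t).expect (fun x => v n x.2)
      ≤ ∑ i ∈ Finset.range n, β ^ i * M.slotCost π s (t + i) := by
    intro n
    induction n with
    | zero => intro t; simp [h0, PMF.expect_const]
    | succ n ih =>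
      intro t
      rw [Finset.sum_range_succ']
      calc _ ≤ M.slotCost π s t + β * (M.law π s (t + 1)).expect (fun x => v n x.2) := by
            rw [expect_law_succ, slotCost, ← PMF.expect_const_mul, ← PMF.expect_add]
            refine PMF.expect_mono _ fun x => ?_
            rw [← PMF.expect_const_mul, ← PMF.expect_add,
              ← PMF.expect_const (π x.1 x.2) (v (n + 1) x.2)]
            exact PMF.expect_mono _ fun a => hv _ _ _
        _ ≤ M.slotCost π s t
            + β * ∑ i ∈ Finset.range n, β ^ i * M.slotCost π s (t + 1 + i) := by
            gcongr; exact ih _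
        _ = _ := by
            rw [Finset.mul_sum, add_comm]
            simp only [pow_zero, one_mul, add_zero, pow_succ']
            congr 1
            refine Finset.sum_congr rfl fun i _ => ?_
            rw [mul_assoc, add_assoc, add_comm 1 i]
  simpa [law, PMF.expect_pure] using key n 0

end MDP

/-! ### From average to discounted costs -/

/-- A linear bound of the partial sums gives the corresponding bound of the discounted sums. -/
lemma ENNReal.discounted_sum_le_of_sum_le {β g : ℝ≥0∞} (hβ : β ≤ 1) (hg : g ≠ ∞) (n : ℕ) :
    ∀ (e : ℕ → ℝ≥0∞) (B : ℝ≥0∞), B ≠ ∞ →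
      (∀ T : ℕ, ∑ t ∈ Finset.range T, e t ≤ g * T + B) →
      ∑ t ∈ Finset.range n, β ^ t * e t ≤ (∑ t ∈ Finset.range n, β ^ t) * g + B := by
  induction n with
  | zero => intro e B _ _; simp
  | succ n ih =>
    intro e B hB h
    have he : e 0 ≤ B + g := by simpa [add_comm] using h 1
    -- The slack `c = B + g - e 0` is the additive constant of the shifted sequence, hence the
    -- quantification over `e` and `B` inside the induction.
    obtain ⟨c, hc⟩ := exists_add_of_le he
    have hfin : B + g ≠ ∞ := ENNReal.add_ne_top.2 ⟨hB, hg⟩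
    have he' : e 0 ≠ ∞ := ne_top_of_le_ne_top hfin he
    have hc' : c ≠ ∞ := by rintro rfl; simp [hc] at hfin
    have := ih (fun t => e (t + 1)) c hc' fun T => by
      have h1 := h (T + 1)
      rw [Finset.sum_range_succ', add_comm] at h1
      refine (ENNReal.add_le_add_iff_left he').1 (h1.trans_eq ?_)
      push_cast
      calc g * (T + 1) + B = g * T + (B + g) := by ring
        _ = _ := by rw [hc]; ring
    calc ∑ t ∈ Finset.range (n + 1), β ^ t * e t
        = e 0 + β * ∑ t ∈ Finset.range n, β ^ t * e (t + 1) := by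
          rw [Finset.sum_range_succ', Finset.mul_sum, add_comm]
          simp [pow_succ', mul_assoc]
      _ ≤ e 0 + β * ((∑ t ∈ Finset.range n, β ^ t) * g + c) := by gcongr
      _ = β * (∑ t ∈ Finset.range n, β ^ t) * g + (e 0 + β * c) := by ring
      _ ≤ β * (∑ t ∈ Finset.range n, β ^ t) * g + (e 0 + 1 * c) := by gcongr
      _ = β * (∑ t ∈ Finset.range n, β ^ t) * g + (B + g) := by rw [hc, one_mul]
      _ = _ := by
          rw [Finset.sum_range_succ', Finset.mul_sum]
          simp only [pow_succ', pow_zero]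
          ring

lemma ENNReal.geom_sum_le_inv {β γ : ℝ≥0∞} (h : β + γ = 1) (n : ℕ) :
    ∑ t ∈ Finset.range n, β ^ t ≤ γ⁻¹ := by
  have hβ : β ≠ ∞ := by rintro rfl; simp at h
  have : γ = 1 - β := by rw [← h, ENNReal.add_sub_cancel_left hβ]
  rw [this, ← ENNReal.tsum_geometric]
  exact ENNReal.sum_le_tsum _

namespace MDP

variable {S α : Type*} (M : MDP S α)

/-- An Abelian bound: the discounted values grow at most like the average cost. -/
lemma exists_iterate_le_of_avgCost_lt {s : S} {g : ℝ≥0∞} (hg : M.optAvgCost s < g)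
    (hg' : g ≠ ∞) :
    ∃ B : ℝ≥0∞, B ≠ ∞ ∧ ∀ (β γ : ℝ≥0∞) (v : ℕ → S → ℝ≥0∞), β + γ = 1 → (∀ s, v 0 s = 0) →
      (∀ n s a, v (n + 1) s ≤ M.cost s a + β * (M.step s a).expect (v n)) →
      ∀ n, v n s ≤ γ⁻¹ * g + B := by
  obtain ⟨π, hπ⟩ := iInf_lt_iff.1 hg
  obtain ⟨T₀, hT₀⟩ := eventually_atTop.1 (eventually_lt_of_limsup_lt hπ)
  have hsum := M.expectedCost_eq_sum π s
  have hlin : ∀ T, max T₀ 1 ≤ T → M.expectedCost π s T ≤ g * T := by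
    intro T hT
    have h1 := (hT₀ T ((le_max_left _ _).trans hT)).le
    have : 1 ≤ T := (le_max_right _ _).trans hT
    rwa [ENNReal.div_le_iff (by exact_mod_cast (by omega : T ≠ 0))
      (ENNReal.natCast_ne_top T)] at h1
  -- Partial sums before `max T₀ 1` are at most the one at that time. The constant is chosen before
  -- `β`, so it disappears in the vanishing discount limit.
  refine ⟨g * (max T₀ 1 : ℕ), ENNReal.mul_ne_top hg' (ENNReal.natCast_ne_top _), ?_⟩
  intro β γ v hβγ h0 hv n
  refine (M.iterate_le_discounted_cost h0 hv π s n).trans ?_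
  refine (ENNReal.discounted_sum_le_of_sum_le (hβγ ▸ le_self_add) hg' n _ _
    (ENNReal.mul_ne_top hg' (ENNReal.natCast_ne_top (max T₀ 1))) fun T => ?_).trans ?_
  · rw [← hsum]
    rcases le_total (max T₀ 1) T with h | h
    · exact (hlin T h).trans le_self_add
    · refine le_trans ?_ (le_add_left (hlin _ le_rfl))
      rw [hsum, hsum]
      exact Finset.sum_le_sum_of_subset (Finset.range_mono h)
  · gcongr
    exact ENNReal.geom_sum_le_inv hβγ n

end MDP

namespace UpdateSystem

variable (M : UpdateSystem)

/-! ### Slots -/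

lemma succSlot_iterate {k : ℕ} (h1 : 1 ≤ k) (hk : k ≤ M.K) (d : ℕ) :
    M.succSlot^[d] k = (k - 1 + d) % M.K + 1 := by
  induction d with
  | zero =>
    have := M.K_pos
    rw [Function.iterate_zero_apply, add_zero, Nat.mod_eq_of_lt (by omega)]
    omega
  | succ d ih =>
    rw [Function.iterate_succ_apply', ih, succSlot, Nat.mod_add_mod, add_assoc]

lemma succSlot_iterate_K {k : ℕ} (h1 : 1 ≤ k) (hk : k ≤ M.K) : M.succSlot^[M.K] k = k := by
  have := M.K_pos
  rw [M.succSlot_iterate h1 hk, Nat.add_mod_right, Nat.mod_eq_of_lt (by omega)]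
  omega

lemma exists_succSlot_iterate_eq {k l : ℕ} (h1 : 1 ≤ k) (hk : k ≤ M.K) (hl1 : 1 ≤ l)
    (hl : l ≤ M.K) : ∃ d < M.K, M.succSlot^[d] k = l := by
  have := M.K_pos
  refine ⟨(M.K + l - k) % M.K, Nat.mod_lt _ M.K_pos, ?_⟩
  rw [M.succSlot_iterate h1 hk, Nat.add_mod_mod,
    show k - 1 + (M.K + l - k) = l - 1 + M.K by omega, Nat.add_mod_right,
    Nat.mod_eq_of_lt (by omega)]
  omega

lemma one_le_succSlot (k : ℕ) : 1 ≤ M.succSlot k := by simp [succSlot]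

lemma succSlot_le (k : ℕ) : M.succSlot k ≤ M.K := Nat.mod_lt _ M.K_pos

lemma succSlot_predSlot {k : ℕ} (h1 : 1 ≤ k) (hk : k ≤ M.K) :
    M.succSlot (M.predSlot k) = k := by
  have := M.K_pos
  rw [succSlot, predSlot, Nat.mod_add_mod, show M.K + k - 2 + 1 = k - 1 + M.K by omega,
    Nat.add_mod_right, Nat.mod_eq_of_lt (by omega)]
  omega

/-! ### The order of the states and redirections -/

/-- The state `s` is at least as good as `s'`: its age is smaller and its belief larger. -/
def Dominates (s s' : State) : Prop :=
  s.age ≤ s'.age ∧ s.slot = s'.slot ∧ s'.belief ≤ s.belief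

lemma Dominates.refl (s : State) : Dominates s s := ⟨le_rfl, rfl, le_rfl⟩

/-- The states that occur, without the arithmetic constraints on age and belief. -/
def Regular (s : State) : Prop :=
  s.belief ≤ M.p11 ∧ ∃ k, 1 ≤ k ∧ k ≤ M.K ∧ s.slot = M.succSlot k ∧ k ≤ s.age

/-- The state after a delivery in slot `k`. -/
def renewal (k : ℕ) : State := ⟨k, M.succSlot k, M.p11⟩

variable {M}

lemma Regular.one_le_slot {s : State} (hs : M.Regular s) : 1 ≤ s.slot := by
  obtain ⟨-, k, -, -, h, -⟩ := hs
  exact h ▸ M.one_le_succSlot k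

lemma Regular.slot_le {s : State} (hs : M.Regular s) : s.slot ≤ M.K := by
  obtain ⟨-, k, -, -, h, -⟩ := hs
  exact h ▸ M.succSlot_le k

/-- Makes delivery at least as good as failure: the new age `s.slot` does not exceed `s.age + 1`. -/
lemma Regular.slot_le_age {s : State} (hs : M.Regular s) : s.slot ≤ s.age + 1 := by
  obtain ⟨-, k, -, -, h, h'⟩ := hs
  have := Nat.mod_le k M.K
  rw [h, succSlot]
  omega

lemma regular_renewal {k : ℕ} (h1 : 1 ≤ k) (hk : k ≤ M.K) : M.Regular (M.renewal k) :=
  ⟨le_rfl, k, h1, hk, rfl, le_rfl⟩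

lemma Regular.next {s : State} (hs : M.Regular s) (u θ : Bool) : M.Regular (M.next s u θ) := by
  refine ⟨?_, s.slot, hs.one_le_slot, hs.slot_le, rfl, ?_⟩
  · cases u
    · exact M.beliefStep_le_p11 _
    · cases θ
      · exact M.p01_le_p11
      · exact le_rfl
  · simp only [UpdateSystem.next]
    split_ifs
    · exact le_rfl
    · exact hs.slot_le_age

lemma regular_of_mem {s : State} (hs : s ∈ M.stateSpace) : M.Regular s := by
  obtain ⟨h1, hk, ⟨m, hm⟩, i, -, hb⟩ := hs
  refine ⟨?_, M.predSlot s.slot, by simp [predSlot], Nat.mod_lt _ M.K_pos,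
    (M.succSlot_predSlot h1 hk).symm, hm ▸ Nat.le_add_left _ _⟩
  rcases hb with hb | hb
  · rw [hb]
    cases i with
    | zero => exact M.p01_le_p11
    | succ i => rw [Function.iterate_succ_apply']; exact M.beliefStep_le_p11 _
  · rw [hb]
    cases i with
    | zero => exact le_rfl
    | succ i => rw [Function.iterate_succ_apply']; exact M.beliefStep_le_p11 _

variable (M) in
/-- A map that improves every state and is compatible with the order. -/
structure IsRedirection (ν : State → State) : Prop where
  dominates : ∀ s, Dominates (ν s) s
  mono : ∀ {s s'}, Dominates s s' → Dominates (ν s) (ν s')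
  regular : ∀ {s}, M.Regular s → M.Regular (ν s)

lemma isRedirection_id : M.IsRedirection id := ⟨Dominates.refl, id, id⟩

variable (M) in
lemma le_clipBelief (N : ℕ) (ω : unitInterval) : ω ≤ M.clipBelief N ω := by
  unfold clipBelief
  split_ifs with h
  · exact h.2.le
  · exact le_rfl

variable (M) in
lemma clipBelief_mono (N : ℕ) : Monotone (M.clipBelief N) := by
  intro a b hab
  by_cases ha : M.beliefStep^[N] M.p01 < a ∧ a < M.beliefStep^[N] M.p11
  · rw [clipBelief, if_pos ha]
    unfold clipBelief
    split_ifs with hb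
    · exact le_rfl
    · by_contra hlt
      exact hb ⟨ha.1.trans_le hab, not_le.1 hlt⟩
  · rw [clipBelief, if_neg ha]
    exact hab.trans (M.le_clipBelief N b)

variable (M) in
lemma beliefStep_iterate_p11_le (N : ℕ) : M.beliefStep^[N] M.p11 ≤ M.p11 := by
  cases N with
  | zero => exact le_rfl
  | succ i => rw [Function.iterate_succ_apply']; exact M.beliefStep_le_p11 _

/-- The belief is rounded upwards, which improves the state. The hypothesis `M.K ≤ N` keeps the
clipped age above the previous slot index, as regularity demands. -/
lemma isRedirection_nu {N : ℕ} (hN : M.K ≤ N) : M.IsRedirection (M.nu N) where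
  dominates s := ⟨min_le_left _ _, rfl, M.le_clipBelief N _⟩
  mono h := ⟨min_le_min_right _ h.1, h.2.1, M.clipBelief_mono N h.2.2⟩
  regular := by
    rintro s ⟨hb, k, h1, hk, hs, ha⟩
    refine ⟨?_, k, h1, hk, hs, le_min ha (hk.trans hN)⟩
    change M.clipBelief N s.belief ≤ M.p11
    unfold clipBelief
    split_ifs
    · exact M.beliefStep_iterate_p11_le N
    · exact hb

variable (M) in
-- The iterates from `p01` increase and those from `p11` decrease, so a belief reached in `i` steps
-- lies outside the open gap for every `N ≥ i`.
lemma eventually_nu_eq {s : State} (hs : s ∈ M.stateSpace) : ∀ᶠ N in atTop, M.nu N s = s := by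
  obtain ⟨-, -, -, i, -, hb⟩ := hs
  filter_upwards [eventually_ge_atTop s.age, eventually_ge_atTop i] with N h1 h2
  have hc : M.clipBelief N s.belief = s.belief := by
    unfold clipBelief
    refine if_neg fun h => ?_
    rcases hb with hb | hb
    · exact h.1.not_ge
        (hb ▸ M.beliefStep_mono.monotone_iterate_of_le_map (M.p01_le_beliefStep _) h2)
    · exact h.2.not_ge
        (hb ▸ M.beliefStep_mono.antitone_iterate_of_map_le (M.beliefStep_le_p11 _) h2)
  simp [nu, hc, h1]

/-! ### Dynamic programming -/

lemma obs_false_expect (s : State) (f : Bool → ℝ≥0∞) : (obs s false).expect f = f false := by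
  simp [obs, PMF.expect_pure]

lemma obs_true_expect (s : State) (f : Bool → ℝ≥0∞) :
    (obs s true).expect f
      = ENNReal.ofReal s.belief * f true + ENNReal.ofReal (1 - s.belief) * f false := by
  simp [obs, PMF.expect, tsum_fintype]

variable (M)

/-- The cost of an action in a slot and the discounted expectation of `H` at the next state. -/
def actionValue (ν : State → State) (lam : ℝ≥0) (β : ℝ≥0∞) (H : State → ℝ≥0∞) (s : State)
    (u : Bool) : ℝ≥0∞ :=
  lagrangianCost lam s u + β * (obs s u).expect fun θ => H (ν (M.next s u θ))

/-- The dynamic programming operator. -/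
def bellman (ν : State → State) (lam : ℝ≥0) (β : ℝ≥0∞) (H : State → ℝ≥0∞) (s : State) : ℝ≥0∞ :=
  min (M.actionValue ν lam β H s false) (M.actionValue ν lam β H s true)

lemma bellman_le (ν : State → State) (lam : ℝ≥0) (β : ℝ≥0∞) (H : State → ℝ≥0∞) (s : State)
    (u : Bool) : M.bellman ν lam β H s ≤ M.actionValue ν lam β H s u := by
  cases u
  · exact min_le_left _ _
  · exact min_le_right _ _

/-- The optimal discounted costs over finite horizons. -/
def value (ν : State → State) (lam : ℝ≥0) (β : ℝ≥0∞) : ℕ → State → ℝ≥0∞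
  | 0 => fun _ => 0
  | n + 1 => M.bellman ν lam β (value ν lam β n)

variable {M}

/-- Each action has at most two successors, so pointwise convergence suffices. The limit `β` avoids
0 and ∞ because multiplication is discontinuous at 0 · ∞ and `H` may be infinite. -/
lemma tendsto_bellman {ι : Type*} {F : Filter ι} {ν : State → State} {ν' : ι → State → State}
    {lam : ℝ≥0} {β : ℝ≥0∞} {β' : ι → ℝ≥0∞} {H : State → ℝ≥0∞} {H' : ι → State → ℝ≥0∞} {s : State}
    (hβ : Tendsto β' F (𝓝 β)) (h0 : β ≠ 0) (h1 : β ≠ ∞)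
    (hH : ∀ u θ, Tendsto (fun i => H' i (ν' i (M.next s u θ))) F (𝓝 (H (ν (M.next s u θ))))) :
    Tendsto (fun i => M.bellman (ν' i) lam (β' i) (H' i) s) F (𝓝 (M.bellman ν lam β H s)) := by
  have key : ∀ u, Tendsto (fun i => M.actionValue (ν' i) lam (β' i) (H' i) s u) F
      (𝓝 (M.actionValue ν lam β H s u)) := by
    intro u
    refine tendsto_const_nhds.add (ENNReal.Tendsto.mul hβ (Or.inl h0) ?_ (Or.inr h1))
    cases u
    · simp only [obs_false_expect]
      exact hH _ _
    · simp only [obs_true_expect]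
      exact (ENNReal.Tendsto.const_mul (hH _ _) (Or.inr ENNReal.ofReal_ne_top)).add
        (ENNReal.Tendsto.const_mul (hH _ _) (Or.inr ENNReal.ofReal_ne_top))
  exact (key false).min (key true)

lemma actionValue_mono {ν : State → State} {lam : ℝ≥0} {β : ℝ≥0∞} {H H' : State → ℝ≥0∞}
    {s : State} {u : Bool} (h : ∀ θ, H (ν (M.next s u θ)) ≤ H' (ν (M.next s u θ))) :
    M.actionValue ν lam β H s u ≤ M.actionValue ν lam β H' s u := by
  unfold actionValue
  gcongr
  exact PMF.expect_mono _ h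

lemma value_le_succ (ν : State → State) (lam : ℝ≥0) (β : ℝ≥0∞) (n : ℕ) (s : State) :
    M.value ν lam β n s ≤ M.value ν lam β (n + 1) s := by
  induction n generalizing s with
  | zero => exact zero_le
  | succ n ih =>
    exact min_le_min (actionValue_mono fun θ => ih _) (actionValue_mono fun θ => ih _)

/-- A larger belief moves probability from failure to success, and by regularity success leads to
the better state. -/
lemma value_mono {ν : State → State} (hν : M.IsRedirection ν) (lam : ℝ≥0) (β : ℝ≥0∞) (n : ℕ) :
    ∀ {s s' : State}, M.Regular s → M.Regular s' → Dominates s s' →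
      M.value ν lam β n s ≤ M.value ν lam β n s' := by
  induction n with
  | zero => intros; exact le_rfl
  | succ n ih =>
    intro s s' hs hs' h
    have hnext : ∀ u θ, M.value ν lam β n (ν (M.next s u θ))
        ≤ M.value ν lam β n (ν (M.next s' u θ)) := fun u θ => by
      refine ih (hν.regular (hs.next u θ)) (hν.regular (hs'.next u θ)) (hν.mono ⟨?_, ?_, ?_⟩)
      · have h1 := h.1
        have h2 := h.2.1
        simp only [next]
        split_ifs <;> omega
      · simp only [next, h.2.1]
      · cases u
        · exact M.beliefStep_mono h.2.2
        · exact le_rfl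
    have hcost : ∀ u, lagrangianCost lam s u ≤ lagrangianCost lam s' u := fun u => by
      unfold lagrangianCost
      have := h.1
      gcongr
    refine min_le_min ?_ ?_
    · unfold actionValue
      simp only [obs_false_expect]
      gcongr
      · exact hcost _
      · exact hnext _ _
    · unfold actionValue
      simp only [obs_true_expect]
      refine add_le_add (hcost _) (mul_le_mul_right ?_ _)
      have hAB : M.value ν lam β n (ν (M.next s true true))
          ≤ M.value ν lam β n (ν (M.next s true false)) := by
        refine ih (hν.regular (hs.next _ _)) (hν.regular (hs.next _ _)) (hν.mono ⟨?_, rfl, ?_⟩)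
        · simpa [next] using hs.slot_le_age
        · simpa [next] using M.p01_le_p11
      have hω : (s'.belief : ℝ) ≤ s.belief := h.2.2
      have e1 : ENNReal.ofReal s.belief
          = ENNReal.ofReal s'.belief + ENNReal.ofReal (s.belief - s'.belief) := by
        rw [← ENNReal.ofReal_add s'.belief.2.1 (sub_nonneg.2 hω)]
        congr 1; ring
      have e2 : ENNReal.ofReal (1 - s'.belief)
          = ENNReal.ofReal (s.belief - s'.belief) + ENNReal.ofReal (1 - s.belief) := by
        rw [← ENNReal.ofReal_add (sub_nonneg.2 hω) (sub_nonneg.2 s.belief.2.2)]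
        congr 1; ring
      calc _ ≤ ENNReal.ofReal s'.belief * M.value ν lam β n (ν (M.next s true true))
            + ENNReal.ofReal (1 - s'.belief) * M.value ν lam β n (ν (M.next s true false)) := by
            rw [e1, e2, add_mul, add_mul, add_assoc]
            gcongr
        _ ≤ _ := by gcongr <;> exact hnext _ _

/-- Better redirections give lower costs; this compares the approximation with the belief MDP. -/
lemma value_le_value {ν ν' : State → State} (hν : M.IsRedirection ν) (hν' : M.IsRedirection ν')
    (h : ∀ s, Dominates (ν s) (ν' s)) (lam : ℝ≥0) (β : ℝ≥0∞) (n : ℕ) {s : State}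
    (hs : M.Regular s) : M.value ν lam β n s ≤ M.value ν' lam β n s := by
  induction n generalizing s with
  | zero => exact le_rfl
  | succ n ih =>
    have key : ∀ u, M.actionValue ν lam β (M.value ν lam β n) s u
        ≤ M.actionValue ν' lam β (M.value ν' lam β n) s u := fun u => by
      unfold actionValue
      gcongr
      refine PMF.expect_mono _ fun θ => ?_
      have hr := hs.next u θ
      exact (value_mono hν lam β n (hν.regular hr) (hν'.regular hr) (h _)).trans
        (ih (hν'.regular hr))
    exact min_le_min (key _) (key _)

/-- Never transmitting lets the age grow by at most one per slot. The bound makes the minimal value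
finite, so that it can be subtracted. -/
lemma value_le_affine {ν : State → State} (hν : M.IsRedirection ν) (lam : ℝ≥0) {β γ : ℝ≥0∞}
    (h : β + γ = 1) (hγ : γ ≠ 0) (n : ℕ) (s : State) :
    M.value ν lam β n s ≤ γ⁻¹ * s.age + γ⁻¹ * γ⁻¹ := by
  have hγ' : γ ≠ ∞ := by rintro rfl; simp at h
  have hb : β * γ⁻¹ + 1 = γ⁻¹ := by
    rw [← ENNReal.mul_inv_cancel hγ hγ', ← add_mul, h, one_mul]
  have hβ : β ≤ 1 := h ▸ le_self_add
  induction n generalizing s with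
  | zero => exact zero_le
  | succ n ih =>
    refine (M.bellman_le _ _ _ _ _ false).trans ?_
    unfold actionValue
    rw [obs_false_expect]
    have hage : ((ν (M.next s false false)).age : ℝ≥0∞) ≤ s.age + 1 := by
      exact_mod_cast (hν.dominates _).1
    generalize hc : γ⁻¹ = b at *
    calc _ ≤ (s.age : ℝ≥0∞) + β * (b * (s.age + 1) + b * b) := by
          simp only [lagrangianCost]
          gcongr
          · simp
          · exact (ih _).trans (by gcongr)
      _ = (β * b + 1) * s.age + (β * b + (β * b) * b) := by ring
      _ ≤ (β * b + 1) * s.age + (1 * b + (β * b) * b) := by gcongr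
      _ = (β * b + 1) * s.age + (β * b + 1) * b := by ring
      _ = _ := by rw [hb]

/-! ### Relative values -/

/-- Beliefs above `δ` persist: every transmission from such a belief succeeds with probability at
least `δ`. -/
structure Persistent (M : UpdateSystem) (δ : unitInterval) : Prop where
  pos : 0 < δ
  step : ∀ {ω}, δ ≤ ω → δ ≤ M.beliefStep ω
  reset : ∀ {ω}, δ ≤ ω → ω = 1 ∨ δ ≤ M.p01

/-- A bound for the optimal cost until a delivery in a given slot, after `d` idle slots. -/
def waitBound (M : UpdateSystem) (lam : ℝ≥0) (δ : unitInterval) (d Δ : ℝ) : ℝ :=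
  (M.K / δ + d) * (Δ + (lam + M.K / δ * M.K) + d)

/-- Idle for `d` slots until slot `k`, then transmit in slot `k` of every frame. Delivery leads to
`renewal k`, and each attempt succeeds with probability at least `δ`. -/
lemma value_le_add_waitBound {ν : State → State} (hν : M.IsRedirection ν) (lam : ℝ≥0)
    {β : ℝ≥0∞} (hβ : β ≤ 1) {δ : unitInterval} (hδ : M.Persistent δ) {k : ℕ} (h1 : 1 ≤ k)
    (hk : k ≤ M.K) {m : ℝ≥0∞} (hm : ∀ n, M.value ν lam β n (M.renewal k) ≤ m) (n : ℕ) :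
    ∀ (d : ℕ) (s : State), d < M.K → M.succSlot^[d] s.slot = k → M.Regular s → δ ≤ s.belief →
      M.value ν lam β n s ≤ m + ENNReal.ofReal (M.waitBound lam δ d s.age) := by
  have hδ0 : (0 : ℝ) < δ := hδ.pos
  have hδ1 : (δ : ℝ) ≤ 1 := δ.2.2
  have hK : (1 : ℝ) ≤ M.K := by exact_mod_cast M.K_pos
  have hKδ : (0 : ℝ) ≤ M.K / δ := by positivity
  induction n with
  | zero => intros; exact zero_le
  | succ n ih =>
    intro d s hd hslot hs hω
    cases d with
    | zero =>
      rw [Function.iterate_zero_apply] at hslot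
      refine (M.bellman_le _ _ _ _ _ true).trans ?_
      unfold actionValue
      rw [obs_true_expect]
      have hsucc : M.value ν lam β n (ν (M.next s true true)) ≤ m := by
        have : M.next s true true = M.renewal k := by
          simp [next, renewal, hslot]
        rw [this]
        exact (value_mono hν lam β n (hν.regular (regular_renewal h1 hk)) (regular_renewal h1 hk)
          (hν.dominates _)).trans (hm n)
      set w : ℝ := M.waitBound lam δ (M.K - 1) (s.age + 1) with hw
      have hw0 : 0 ≤ w := by
        rw [hw, waitBound]
        have : (0 : ℝ) ≤ M.K - 1 := by linarith
        positivity
      have hfail : ENNReal.ofReal (1 - s.belief) * M.value ν lam β n (ν (M.next s true false))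
          ≤ ENNReal.ofReal (1 - s.belief) * m + ENNReal.ofReal ((1 - δ) * w) := by
        -- Either failure has probability zero, or the belief `p01` after it is still at least `δ`;
        -- then `M.K - 1` idle slots lead back to slot `k`.
        rcases hδ.reset hω with h | h
        · simp [h]
        · have hdom := hν.dominates (M.next s true false)
          have hd1 : ((ν (M.next s true false)).age : ℝ) ≤ s.age + 1 := by
            exact_mod_cast hdom.1
          have hv := ih (M.K - 1) (ν (M.next s true false)) (by have := M.K_pos; omega) (by
              rw [hdom.2.1]
              change M.succSlot^[M.K - 1] (M.succSlot s.slot) = k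
              rw [← Function.iterate_succ_apply, hslot, Nat.succ_eq_add_one,
                Nat.sub_add_cancel M.K_pos, M.succSlot_iterate_K h1 hk])
            (hν.regular (hs.next _ _)) (h.trans hdom.2.2)
          have hle : M.waitBound lam δ ((M.K - 1 : ℕ) : ℝ) (ν (M.next s true false)).age ≤ w := by
            rw [hw, waitBound, waitBound, Nat.cast_sub M.K_pos, Nat.cast_one]
            have : (0 : ℝ) ≤ M.K - 1 := by linarith
            gcongr
          calc _ ≤ ENNReal.ofReal (1 - s.belief) * (m + ENNReal.ofReal w) := by
                gcongr
                exact hv.trans (by gcongr)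
            _ = ENNReal.ofReal (1 - s.belief) * m + ENNReal.ofReal ((1 - s.belief) * w) := by
                rw [mul_add, ENNReal.ofReal_mul (sub_nonneg.2 s.belief.2.2)]
            _ ≤ _ := by gcongr
      have hsum : ENNReal.ofReal s.belief * m + ENNReal.ofReal (1 - s.belief) * m = m := by
        rw [← add_mul, ← ENNReal.ofReal_add s.belief.2.1 (sub_nonneg.2 s.belief.2.2)]
        simp
      have hcost : lagrangianCost lam s true = ENNReal.ofReal ((s.age : ℝ) + (lam : ℝ)) := by
        rw [ENNReal.ofReal_add (Nat.cast_nonneg _) lam.coe_nonneg]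
        simp [lagrangianCost]
      have hreal : (s.age : ℝ) + (lam : ℝ) + (1 - (δ : ℝ)) * w ≤ M.waitBound lam δ (0 : ℕ) s.age := by
        rw [hw, waitBound, waitBound]
        have hA : (M.K : ℝ) / δ * δ = M.K := div_mul_cancel₀ _ hδ0.ne'
        set A : ℝ := M.K / δ
        -- Since `A * δ = K`, a failed frame shortens the first factor of `waitBound`; the summand
        -- `A * K` in the second absorbs the growth of age by `K`.
        have hq : (1 - δ) * (A + (M.K - 1)) ≤ A - 1 := by nlinarith
        have hp : (0 : ℝ) ≤ s.age + 1 + (lam + A * M.K) + (M.K - 1) := by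
          have : (0 : ℝ) ≤ M.K - 1 := by linarith
          positivity
        have := mul_le_mul_of_nonneg_right hq hp
        have hl := lam.coe_nonneg
        push_cast
        nlinarith
      calc _ ≤ lagrangianCost lam s true + 1 * (ENNReal.ofReal s.belief * m
            + (ENNReal.ofReal (1 - s.belief) * m + ENNReal.ofReal ((1 - δ) * w))) := by
            gcongr
        _ = m + ENNReal.ofReal ((s.age : ℝ) + (lam : ℝ) + (1 - (δ : ℝ)) * w) := by
            rw [one_mul, ← add_assoc (ENNReal.ofReal s.belief * m), hsum, hcost,
              ENNReal.ofReal_add (by positivity) (mul_nonneg (sub_nonneg.2 hδ1) hw0)]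
            ring
        _ ≤ _ := by gcongr
    | succ d =>
      refine (M.bellman_le _ _ _ _ _ false).trans ?_
      unfold actionValue
      rw [obs_false_expect]
      have hdom := hν.dominates (M.next s false false)
      have hd1 : ((ν (M.next s false false)).age : ℝ) ≤ s.age + 1 := by exact_mod_cast hdom.1
      have hv := ih d (ν (M.next s false false)) (by omega) (by
          rw [hdom.2.1]
          exact hslot)
        (hν.regular (hs.next _ _)) ((hδ.step hω).trans hdom.2.2)
      have hw0 : 0 ≤ M.waitBound lam δ d (s.age + 1) := by
        rw [waitBound]
        positivity
      have hle : M.waitBound lam δ d (ν (M.next s false false)).age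
          ≤ M.waitBound lam δ d (s.age + 1) := by
        rw [waitBound, waitBound]
        gcongr
      have hcost : lagrangianCost lam s false = ENNReal.ofReal s.age := by
        simp [lagrangianCost]
      calc _ ≤ ENNReal.ofReal s.age
            + 1 * (m + ENNReal.ofReal (M.waitBound lam δ d (s.age + 1))) := by
            rw [hcost]
            gcongr
            exact hv.trans (by gcongr)
        _ = m + ENNReal.ofReal (s.age + M.waitBound lam δ d (s.age + 1)) := by
            rw [one_mul, ENNReal.ofReal_add (Nat.cast_nonneg _) hw0]
            ring
        _ ≤ _ := by
            gcongr
            rw [waitBound, waitBound]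
            push_cast
            have : (0 : ℝ) ≤ lam + M.K / δ * M.K + d := by positivity
            nlinarith

/-- The discounted optimality inequality for the relative values. -/
lemma exists_relative_value {ν : State → State} (hν : M.IsRedirection ν) (lam : ℝ≥0)
    {β γ : ℝ≥0∞} (h : β + γ = 1) (hβ0 : β ≠ 0) (hγ : γ ≠ 0) :
    ∃ (m : ℝ≥0∞) (H : State → ℝ≥0∞),
      (∀ s, M.Regular s → m ≤ ⨆ n, M.value ν lam β n s) ∧
      (∀ s, M.Regular s → M.bellman ν lam β H s ≤ γ * m + H s) ∧
      ∀ δ, M.Persistent δ → ∀ s, M.Regular s → δ ≤ s.belief →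
        H s ≤ ENNReal.ofReal (M.waitBound lam δ M.K s.age) := by
  have hβ : β ≤ 1 := h ▸ le_self_add
  set V : State → ℝ≥0∞ := fun s => ⨆ n, M.value ν lam β n s with hV
  obtain ⟨k, hk, hmin⟩ := Finset.exists_min_image (Finset.Icc 1 M.K) (fun k => V (M.renewal k))
    ⟨1, Finset.mem_Icc.2 ⟨le_rfl, M.K_pos⟩⟩
  obtain ⟨h1, hk⟩ := Finset.mem_Icc.1 hk
  -- Every regular state is dominated by a renewal state with the same slot, so the minimum over the
  -- finitely many renewal states is global.
  have hm : ∀ s, M.Regular s → V (M.renewal k) ≤ V s := by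
    rintro s hs
    obtain ⟨hb, l, hl1, hl, hslot, hage⟩ := id hs
    refine (hmin l (Finset.mem_Icc.2 ⟨hl1, hl⟩)).trans (iSup_mono fun n => ?_)
    exact value_mono hν lam β n (regular_renewal hl1 hl) hs ⟨hage, hslot.symm, hb⟩
  have hfin : V (M.renewal k) ≠ ∞ := by
    refine ne_top_of_le_ne_top ?_ (iSup_le fun n => value_le_affine hν lam h hγ n _)
    have := ENNReal.inv_ne_top.2 hγ
    exact ENNReal.add_ne_top.2 ⟨ENNReal.mul_ne_top this (ENNReal.natCast_ne_top _),
      ENNReal.mul_ne_top this this⟩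
  have hsplit : ∀ s, M.Regular s → V (M.renewal k) + (V s - V (M.renewal k)) = V s :=
    fun s hs => add_tsub_cancel_of_le (hm s hs)
  refine ⟨V (M.renewal k), fun s => V s - V (M.renewal k), hm, fun s hs => ?_, ?_⟩
  · have hfix : M.bellman ν lam β V s ≤ V s := by
      have hlim : Tendsto (fun n => M.bellman ν lam β (M.value ν lam β n) s) atTop
          (𝓝 (M.bellman ν lam β V s)) :=
        tendsto_bellman tendsto_const_nhds hβ0 (ne_top_of_le_ne_top ENNReal.one_ne_top hβ)
          fun u θ => tendsto_atTop_iSup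
            (monotone_nat_of_le_succ fun n => value_le_succ ν lam β n _)
      exact le_of_tendsto' hlim fun n => le_iSup (fun n => M.value ν lam β n s) (n + 1)
    set m := V (M.renewal k)
    have hact : ∀ u, M.actionValue ν lam β V s u
        = β * m + M.actionValue ν lam β (fun s => V s - m) s u := by
      intro u
      unfold actionValue
      have : (fun θ => V (ν (M.next s u θ)))
          = fun θ => m + (V (ν (M.next s u θ)) - m) :=
        funext fun θ => (hsplit _ (hν.regular (hs.next u θ))).symm
      rw [this, PMF.expect_add, PMF.expect_const]
      ring
    have hbell : M.bellman ν lam β V s = β * m + M.bellman ν lam β (fun s => V s - m) s := by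
      unfold bellman
      rw [hact, hact, min_add_add_left]
    have hβm : β * m ≠ ∞ := ENNReal.mul_ne_top (ne_top_of_le_ne_top ENNReal.one_ne_top hβ) hfin
    -- Cancelling the finite `β * m` leaves `γ * m` out of `m`.
    refine (ENNReal.add_le_add_iff_left hβm).1 ?_
    calc _ ≤ V s := hbell ▸ hfix
      _ = m + (V s - m) := (hsplit s hs).symm
      _ = (β + γ) * m + (V s - m) := by rw [h, one_mul]
      _ = _ := by ring
  · intro δ hδ s hs hω
    obtain ⟨d, hd, hdk⟩ := M.exists_succSlot_iterate_eq hs.one_le_slot hs.slot_le h1 hk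
    rw [tsub_le_iff_left]
    refine iSup_le fun n => (value_le_add_waitBound hν lam hβ hδ h1 hk
      (fun n => le_iSup (fun n => M.value ν lam β n (M.renewal k)) n) n d s hd hdk hs hω).trans ?_
    have hδ0 : (0 : ℝ) < δ := hδ.pos
    have hdK : (d : ℝ) ≤ M.K := by exact_mod_cast hd.le
    have : M.waitBound lam δ d s.age ≤ M.waitBound lam δ M.K s.age := by
      unfold waitBound
      gcongr
    gcongr

end UpdateSystem

namespace UpdateSystem

variable (M : UpdateSystem)

/-! ### The gain -/

/-- The MDP whose successor states are redirected through `ν`. -/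
def redirected (S : Set State) (ν : State → State)
    (hS : ∀ s ∈ S, ∀ u θ, ν (M.next s u θ) ∈ S) (lam : ℝ≥0) : MDP S Bool where
  step s u := (obs s u).map fun θ => ⟨ν (M.next s u θ), hS s s.2 u θ⟩
  cost s u := lagrangianCost lam s u

lemma beliefMDP_eq (lam : ℝ≥0) : M.beliefMDP lam
    = M.redirected M.stateSpace id (fun _ hs u θ => M.next_mem hs u θ) lam := rfl

lemma approxMDP_eq (N : ℕ) (lam : ℝ≥0) : M.approxMDP N lam
    = M.redirected (M.approxStateSpace N) (M.nu N) (fun _ hs u θ => M.nu_next_mem N hs u θ) lam :=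
  rfl

variable {M}

lemma redirected_expect {S : Set State} {ν : State → State}
    (hS : ∀ s ∈ S, ∀ u θ, ν (M.next s u θ) ∈ S) (lam : ℝ≥0) (s : S) (u : Bool)
    (H : State → ℝ≥0∞) : ((M.redirected S ν hS lam).step s u).expect (fun r => H r)
      = (obs s u).expect fun θ => H (ν (M.next s u θ)) := by
  simp only [redirected, PMF.expect_map]

lemma optAvgCost_le_of_bellman {S : Set State} {ν : State → State}
    (hS : ∀ s ∈ S, ∀ u θ, ν (M.next s u θ) ∈ S) (lam : ℝ≥0) {g : ℝ≥0∞} {H : State → ℝ≥0∞}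
    (h : ∀ s ∈ S, M.bellman ν lam 1 H s ≤ g + H s) {s : S} (hs : H s ≠ ∞) :
    (M.redirected S ν hS lam).optAvgCost s ≤ g := by
  have hact : ∀ s : S, ∃ u, M.actionValue ν lam 1 H s u ≤ g + H s := fun s => by
    rcases min_le_iff.1 (h s s.2) with h | h
    · exact ⟨_, h⟩
    · exact ⟨_, h⟩
  choose f hf using hact
  refine MDP.optAvgCost_le_of_optimality_ineq _ f (h := fun s => H s) (fun s => ?_) hs
  have := hf s
  rw [actionValue, one_mul] at this
  rw [redirected_expect]
  exact this

lemma exists_tendsto_of_ultrafilter {ι : Type*} (U : Ultrafilter ι) (f : ι → ℝ≥0∞) :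
    ∃ a, Tendsto f U (𝓝 a) := ⟨_, (U.map f).le_nhds_lim⟩

/-- The vanishing discount limit. -/
lemma exists_gain {ν : State → State} (hν : M.IsRedirection ν) (lam : ℝ≥0) :
    ∃ (g : ℝ≥0∞) (H : State → ℝ≥0∞),
      (∀ s, M.Regular s → M.bellman ν lam 1 H s ≤ g + H s) ∧
      (∀ δ, M.Persistent δ → ∀ s, M.Regular s → δ ≤ s.belief →
        H s ≤ ENNReal.ofReal (M.waitBound lam δ M.K s.age)) ∧
      ∀ ν', M.IsRedirection ν' → (∀ s, Dominates (ν s) (ν' s)) →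
        ∀ (S : Set State) (hS : ∀ s ∈ S, ∀ u θ, ν' (M.next s u θ) ∈ S),
          (∀ s ∈ S, M.Regular s) → ∀ s : S, g ≤ (M.redirected S ν' hS lam).optAvgCost s := by
  -- The shift by 2 keeps `1 - γ j` nonzero also for `j = 0`.
  set γ : ℕ → ℝ≥0∞ := fun j => ((j + 2 : ℕ) : ℝ≥0∞)⁻¹ with hγ
  have hγ0 : ∀ j, γ j ≠ 0 := fun j => ENNReal.inv_ne_zero.2 (ENNReal.natCast_ne_top _)
  have hγ1 : ∀ j, γ j < 1 := fun j => by
    rw [hγ, ENNReal.inv_lt_one]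
    exact_mod_cast (by omega : 1 < j + 2)
  have hsum : ∀ j, (1 - γ j) + γ j = 1 := fun j => tsub_add_cancel_of_le (hγ1 j).le
  have hβ0 : ∀ j, 1 - γ j ≠ 0 := fun j => (tsub_pos_of_lt (hγ1 j)).ne'
  have hγlim : Tendsto γ atTop (𝓝 0) :=
    ENNReal.tendsto_inv_nat_nhds_zero.comp (tendsto_add_atTop_nat 2)
  have hβlim : Tendsto (fun j => 1 - γ j) atTop (𝓝 1) := by
    simpa using ENNReal.Tendsto.sub (tendsto_const_nhds (x := (1 : ℝ≥0∞))) hγlim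
      (Or.inl ENNReal.one_ne_top)
  choose m H' hm hbell hbound using fun j => exists_relative_value hν lam (hsum j) (hβ0 j) (hγ0 j)
  set U : Ultrafilter ℕ := hyperfilter ℕ
  have hU : (U : Filter ℕ) ≤ atTop := Nat.hyperfilter_le_atTop
  obtain ⟨g, hg⟩ := exists_tendsto_of_ultrafilter U fun j => γ j * m j
  choose H hH using fun s => exists_tendsto_of_ultrafilter U fun j => H' j s
  refine ⟨g, H, fun s hs => ?_, fun δ hδ s hs hω => ?_, ?_⟩
  · exact le_of_tendsto_of_tendsto'
      (tendsto_bellman (hβlim.mono_left hU) one_ne_zero ENNReal.one_ne_top fun u θ => hH _)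
      (hg.add (hH s)) fun j => hbell j s hs
  · exact le_of_tendsto' (hH s) fun j => hbound j δ hδ s hs hω
  · intro ν' hν' hdom S hS hreg s
    refine ENNReal.le_of_forall_pos_le_add fun ε hε hfin => ?_
    set L := (M.redirected S ν' hS lam).optAvgCost s
    obtain ⟨B, hB, hv⟩ := MDP.exists_iterate_le_of_avgCost_lt (M.redirected S ν' hS lam)
      (ENNReal.lt_add_right hfin.ne (ENNReal.coe_pos.2 hε).ne')
      (ENNReal.add_ne_top.2 ⟨hfin.ne, ENNReal.coe_ne_top⟩)
    have hlim : Tendsto (fun j => (L + ε) + γ j * B) U (𝓝 (L + ε)) := by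
      have := ENNReal.Tendsto.mul_const (hγlim.mono_left hU) (Or.inr hB)
      simpa using tendsto_const_nhds.add this
    refine le_of_tendsto_of_tendsto' hg hlim fun j => ?_
    have hV : m j ≤ (γ j)⁻¹ * (L + ε) + B := by
      refine (hm j s (hreg s s.2)).trans (iSup_le fun n => ?_)
      refine (value_le_value hν hν' hdom lam _ n (hreg s s.2)).trans ?_
      refine hv (1 - γ j) (γ j) (fun n s => M.value ν' lam (1 - γ j) n s) (hsum j)
        (fun _ => rfl) (fun n r u => ?_) n
      rw [redirected_expect]
      exact M.bellman_le ν' lam _ _ r u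
    calc γ j * m j ≤ γ j * ((γ j)⁻¹ * (L + ε) + B) := by gcongr
      _ = _ := by
        rw [mul_add, ← mul_assoc,
          ENNReal.mul_inv_cancel (hγ0 j) (ne_top_of_le_ne_top ENNReal.one_ne_top (hγ1 j).le),
          one_mul]

variable (M) in
lemma regular_of_mem_approx {N : ℕ} (hN : M.K ≤ N) {s : State} (hs : s ∈ M.approxStateSpace N) :
    M.Regular s := by
  obtain ⟨r, hr, rfl⟩ := hs
  exact (isRedirection_nu hN).regular (regular_of_mem hr)

/-- The convergence from states with a belief that stays bounded away from zero. -/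
lemma tendsto_optAvgCost_of_persistent {δ : unitInterval} (hδ : M.Persistent δ) (lam : ℝ≥0)
    (s : M.stateSpace) (hs : δ ≤ s.1.belief) :
    Tendsto (fun N : ℕ => (M.approxMDP N lam).optAvgCost (M.toApprox N s)) atTop
      (𝓝 ((M.beliefMDP lam).optAvgCost s)) := by
  have hex : ∀ N, ∃ (g : ℝ≥0∞) (H : State → ℝ≥0∞), M.K ≤ N →
      (∀ s, M.Regular s → M.bellman (M.nu N) lam 1 H s ≤ g + H s) ∧
      (∀ s, M.Regular s → δ ≤ s.belief →
        H s ≤ ENNReal.ofReal (M.waitBound lam δ M.K s.age)) ∧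
      (M.approxMDP N lam).optAvgCost (M.toApprox N s) = g ∧
      g ≤ (M.beliefMDP lam).optAvgCost s := by
    intro N
    by_cases hN : M.K ≤ N
    · have hν := M.isRedirection_nu hN
      obtain ⟨g, H, h1, h2, h3⟩ := exists_gain hν lam
      refine ⟨g, H, fun _ => ⟨h1, h2 δ hδ, le_antisymm ?_ ?_, ?_⟩⟩
      · rw [approxMDP_eq]
        refine optAvgCost_le_of_bellman _ lam
          (fun s hs => h1 s (M.regular_of_mem_approx hN hs)) (ne_top_of_le_ne_top
            ENNReal.ofReal_ne_top (h2 δ hδ _ (M.regular_of_mem_approx hN (M.toApprox N s).2) ?_))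
        exact hs.trans (M.le_clipBelief N _)
      · rw [approxMDP_eq]
        exact h3 _ hν (fun _ => Dominates.refl _) _ _ (fun s hs => M.regular_of_mem_approx hN hs) _
      · rw [beliefMDP_eq]
        exact h3 _ isRedirection_id hν.dominates _ _ (fun s hs => regular_of_mem hs) _
    -- Dummy values: for `N < M.K` clipping the age can destroy regularity.
    · exact ⟨0, 0, fun h => absurd h hN⟩
  choose g H hgH using hex
  refine tendsto_iff_ultrafilter _ _ _ |>.2 fun U hU => ?_
  have hK : ∀ᶠ N in (U : Filter ℕ), M.K ≤ N := hU (eventually_ge_atTop M.K)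
  obtain ⟨g', hg'⟩ := exists_tendsto_of_ultrafilter U g
  choose H' hH' using fun s => exists_tendsto_of_ultrafilter U fun N => H N s
  have hle : g' ≤ (M.beliefMDP lam).optAvgCost s :=
    le_of_tendsto hg' (hK.mono fun N hN => (hgH N hN).2.2.2)
  have hge : (M.beliefMDP lam).optAvgCost s ≤ g' := by
    rw [beliefMDP_eq]
    refine optAvgCost_le_of_bellman (H := H') _ lam (fun r hr => ?_)
      (ne_top_of_le_ne_top (ENNReal.ofReal_ne_top (r := M.waitBound lam δ M.K s.1.age)) ?_)
    · refine le_of_tendsto_of_tendsto (tendsto_bellman (ν' := fun N => M.nu N) (H' := H)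
        (β' := fun _ => 1) tendsto_const_nhds one_ne_zero ENNReal.one_ne_top fun u θ => ?_)
        (hg'.add (hH' r)) (hK.mono fun N hN => (hgH N hN).1 r (regular_of_mem hr))
      -- Each successor is fixed by `nu N` for large `N`, so the redirection disappears in the
      -- limit.
      refine (hH' (M.next r u θ)).congr' ?_
      filter_upwards [hU (M.eventually_nu_eq (M.next_mem hr u θ))] with N hN
      rw [hN]
    · exact le_of_tendsto (hH' s)
        (hK.mono fun N hN => (hgH N hN).2.1 s (regular_of_mem s.2) hs)
  rw [le_antisymm hge hle]
  exact hg'.congr' (hK.mono fun N hN => (hgH N hN).2.2.1.symm)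

/-! ### Channels that stay bad -/

/-- Drift of the potential `G * min age G`: below `G` it gains `G` in an unsuccessful slot, and from
`G` on the age itself pays `G`. -/
lemma potential_step {G a b : ℕ} (h : min (a + 1) G ≤ b) :
    G + G * min a G ≤ a + G * min b G := by
  rcases lt_or_ge a G with ha | ha
  · have h1 : a + 1 ≤ min b G := by omega
    rw [min_eq_left ha.le]
    nlinarith
  · rw [min_eq_right ha, min_eq_right (by omega)]
    omega

lemma beliefStep_zero (h0 : M.p01 = 0) : M.beliefStep 0 = 0 := by
  ext
  simp [beliefStep, h0]

/-- If the channel stays bad and cannot be good for certain, the optimal average cost is large. -/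
lemma le_optAvgCost_of_p11_lt {S : Set State} {ν : State → State}
    (hS : ∀ s ∈ S, ∀ u θ, ν (M.next s u θ) ∈ S) (lam : ℝ≥0) (h0 : M.p01 = 0) (h1 : M.p11 < 1)
    (hb : ∀ s ∈ S, s.belief ≤ M.p11) {G : ℕ} (hν : ∀ s, min s.age G ≤ (ν s).age)
    (hν0 : ∀ s, s.belief = 0 → (ν s).belief = 0) (s : S) :
    (G : ℝ≥0∞) ≤ (M.redirected S ν hS lam).optAvgCost s := by
  classical
  -- At nonzero belief, `G` plus the potential is at most `G + G * G`. A transmission fails with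
  -- probability at least `1 - p11`, and the bonus `D` for belief zero then pays this amount in
  -- expectation.
  set D : ℝ≥0∞ := (G + G * G) / ENNReal.ofReal (1 - M.p11) with hD
  have h1' : 0 < 1 - (M.p11 : ℝ) := sub_pos.2 h1
  have hp0 : ENNReal.ofReal (1 - M.p11) ≠ 0 := (ENNReal.ofReal_pos.2 h1').ne'
  have hDfin : D ≠ ∞ := ENNReal.div_ne_top
    (by exact_mod_cast ENNReal.natCast_ne_top (G + G * G)) hp0
  set φ : State → ℝ≥0∞ := fun s => (G * min s.age G : ℕ) + if s.belief = 0 then D else 0 with hφ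
  refine MDP.le_optAvgCost_of_potential (M.redirected S ν hS lam) (g := fun _ => (G : ℝ≥0∞))
    (φ := fun s => φ s) (B := (G * G : ℕ) + D) (by simp [hDfin, ENNReal.mul_eq_top]) (fun s => ?_)
    (fun s a => (PMF.expect_const _ _).ge) (fun s u => ?_) s
  · simp only [hφ]
    gcongr
    · exact min_le_right _ _
    · split_ifs <;> simp
  · rw [redirected_expect]
    change _ ≤ lagrangianCost lam s u + _
    have hcost : (s.1.age : ℝ≥0∞) ≤ lagrangianCost lam s u := le_self_add
    refine le_trans ?_ (add_le_add_left hcost _)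
    have hidle : ∀ u, (u = true → s.1.belief = 0) →
        (G : ℝ≥0∞) + φ s ≤ s.1.age + φ (ν (M.next s u false)) := by
      intro u hu
      have hstep := potential_step (G := G) (a := s.1.age) (b := (ν (M.next s u false)).age)
        (by simpa [next] using hν (M.next s u false))
      simp only [hφ]
      rw [← add_assoc, ← add_assoc]
      refine add_le_add (by exact_mod_cast hstep) ?_
      by_cases h : s.1.belief = 0
      · have : (ν (M.next s u false)).belief = 0 := by
          refine hν0 _ ?_
          cases u
          · simp [next, h, beliefStep_zero h0]
          · simp [next, h0]
        simp [h, this]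
      · simp [h]
    cases u
    · rw [obs_false_expect]
      exact hidle false (by simp)
    · rw [obs_true_expect]
      by_cases h : s.1.belief = 0
      · have := hidle true fun _ => h
        simpa [h] using this
      · have hz : (ν (M.next s true false)).belief = 0 := hν0 _ (by simp [next, h0])
        have hω : (s.1.belief : ℝ) ≤ M.p11 := hb s s.2
        calc (G : ℝ≥0∞) + φ s ≤ G + G * G := by
              simp only [hφ, if_neg h, add_zero]
              gcongr
              exact_mod_cast Nat.mul_le_mul_left G (min_le_right _ _)
          _ = ENNReal.ofReal (1 - M.p11) * D :=
              (ENNReal.mul_div_cancel hp0 ENNReal.ofReal_ne_top).symm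
          _ ≤ ENNReal.ofReal (1 - s.1.belief) * φ (ν (M.next s true false)) := by
              simp only [hφ, if_pos hz]
              gcongr
              exact le_add_self
          _ ≤ _ := le_add_left le_add_self

/-- From a channel that is bad for ever, the optimal average cost is large. -/
lemma le_optAvgCost_of_belief_zero {S : Set State} {ν : State → State}
    (hS : ∀ s ∈ S, ∀ u θ, ν (M.next s u θ) ∈ S) (lam : ℝ≥0) (h0 : M.p01 = 0)
    {G : ℕ} (hν : ∀ s, min s.age G ≤ (ν s).age)
    (hν0 : ∀ s, s.belief = 0 → (ν s).belief = 0) (s : S) (hs : s.1.belief = 0) :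
    (G : ℝ≥0∞) ≤ (M.redirected S ν hS lam).optAvgCost s := by
  classical
  -- Belief zero is absorbing. The gain must vanish elsewhere, since `p11 = 1` is allowed and other
  -- states may be cheap.
  set g : State → ℝ≥0∞ := fun s => if s.belief = 0 then (G : ℝ≥0∞) else 0 with hg
  set φ : State → ℝ≥0∞ := fun s => if s.belief = 0 then ((G * min s.age G : ℕ) : ℝ≥0∞) else 0
    with hφ
  have hzero : ∀ r : State, r.belief = 0 → ∀ u, (ν (M.next r u false)).belief = 0 := by
    intro r h u
    refine hν0 _ ?_
    cases u
    · simp [next, h, beliefStep_zero h0]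
    · simp [next, h0]
  have hexp : ∀ (r : State), r.belief = 0 → ∀ (u : Bool) (F : Bool → ℝ≥0∞),
      (obs r u).expect F = F false := by
    intro r h u F
    cases u
    · exact obs_false_expect _ _
    · simp [obs_true_expect, h]
  have key := MDP.le_optAvgCost_of_potential (M.redirected S ν hS lam) (g := fun s => g s)
    (φ := fun s => φ s) (B := (G * G : ℕ)) (ENNReal.natCast_ne_top _) (fun r => ?_)
    (fun r u => ?_) (fun r u => ?_) s
  · simpa [hg, hs] using key
  · simp only [hφ]
    split_ifs
    · exact_mod_cast Nat.mul_le_mul_left G (min_le_right _ _)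
    · exact zero_le
  · rw [redirected_expect]
    by_cases h : r.1.belief = 0
    · rw [hexp r h]
      simp [hg, h, hzero r h u]
    · simp [hg, h]
  · rw [redirected_expect]
    by_cases h : r.1.belief = 0
    · have hstep := potential_step (G := G) (a := r.1.age) (b := (ν (M.next r u false)).age)
        (by simpa [next] using hν (M.next r u false))
      rw [hexp r h]
      simp only [hg, hφ, if_pos h, if_pos (hzero r h u)]
      calc _ ≤ (r.1.age : ℝ≥0∞) + (G * min (ν (M.next r u false)).age G : ℕ) := by
            exact_mod_cast hstep
        _ ≤ _ := add_le_add_left le_self_add _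
    · simp [hg, hφ, h]

/-- The divergence from states in which the channel is bad from some slot on. -/
lemma tendsto_optAvgCost_of_bad (h0 : M.p01 = 0) (lam : ℝ≥0) (s : M.stateSpace)
    (h : M.p11 < 1 ∨ s.1.belief = 0) :
    Tendsto (fun N : ℕ => (M.approxMDP N lam).optAvgCost (M.toApprox N s)) atTop
      (𝓝 ((M.beliefMDP lam).optAvgCost s)) := by
  have hclip : ∀ N (r : State), r.belief = 0 → (M.nu N r).belief = 0 := by
    intro N r hr
    change M.clipBelief N r.belief = 0
    rw [hr]
    exact if_neg fun h => (unitInterval.nonneg' (t := M.beliefStep^[N] M.p01)).not_gt h.1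
  have htop : (M.beliefMDP lam).optAvgCost s = ∞ := by
    refine ENNReal.eq_top_of_forall_nnreal_le fun r => ?_
    obtain ⟨G, hG⟩ := exists_nat_ge r
    refine le_trans (b := (G : ℝ≥0∞)) (by exact_mod_cast hG) ?_
    rw [beliefMDP_eq]
    rcases h with h | h
    · exact le_optAvgCost_of_p11_lt _ lam h0 h (fun s hs => (regular_of_mem hs).1)
        (fun _ => min_le_left _ _) (fun _ => id) s
    · exact le_optAvgCost_of_belief_zero _ lam h0 (fun _ => min_le_left _ _) (fun _ => id) s h
  rw [htop, ENNReal.tendsto_nhds_top_iff_nat]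
  intro n
  filter_upwards [eventually_ge_atTop M.K, eventually_ge_atTop (n + 1)] with N hN hn
  refine lt_of_lt_of_le (b := ((n + 1 : ℕ) : ℝ≥0∞)) (by exact_mod_cast n.lt_succ_self) ?_
  have hage : ∀ s, min s.age (n + 1) ≤ (M.nu N s).age := fun s => min_le_min_left _ hn
  rw [approxMDP_eq]
  rcases h with h | h
  · exact le_optAvgCost_of_p11_lt _ lam h0 h (fun s hs => (M.regular_of_mem_approx hN hs).1)
      hage (hclip N) _
  · exact le_optAvgCost_of_belief_zero _ lam h0 hage (hclip N) _ (hclip N _ h)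

lemma persistent_p01 (h : 0 < M.p01) : M.Persistent M.p01 :=
  ⟨h, fun _ => M.p01_le_beliefStep _, fun _ => Or.inr le_rfl⟩

lemma persistent_one (h : M.p11 = 1) : M.Persistent 1 where
  pos := zero_lt_one
  step := by
    intro ω hω
    have hω1 : ω = 1 := le_antisymm unitInterval.le_one' hω
    have : M.beliefStep ω = 1 := by
      ext
      simp [beliefStep, hω1, h]
    exact this.ge
  reset hω := Or.inl (le_antisymm unitInterval.le_one' hω)

lemma beliefStep_eq_self (h0 : M.p01 = 0) (h1 : M.p11 = 1) (ω : unitInterval) :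
    M.beliefStep ω = ω := by
  ext
  simp [beliefStep, h0, h1]

end UpdateSystem

end

theorem theorem3 (M : UpdateSystem) (lam : ℝ≥0) (s : M.stateSpace) :
    Tendsto (fun N : ℕ => (M.approxMDP N lam).optAvgCost (M.toApprox N s)) atTop
      (𝓝 ((M.beliefMDP lam).optAvgCost s)) := by
  rcases (unitInterval.nonneg' (t := M.p01)).lt_or_eq with h0 | h0
  · refine UpdateSystem.tendsto_optAvgCost_of_persistent (UpdateSystem.persistent_p01 h0) lam s ?_
    obtain ⟨-, -, -, i, -, hb⟩ := s.2
    rcases hb with hb | hb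
    · rw [hb]
      exact M.beliefStep_mono.monotone_iterate_of_le_map (M.p01_le_beliefStep _) i.zero_le
    · rw [hb]
      cases i with
      | zero => exact M.p01_le_p11
      | succ i => rw [Function.iterate_succ_apply']; exact M.p01_le_beliefStep _
  · rcases (unitInterval.le_one' (t := M.p11)).lt_or_eq with h1 | h1
    · exact UpdateSystem.tendsto_optAvgCost_of_bad h0.symm lam s (Or.inl h1)
    · obtain ⟨-, -, -, i, -, hb⟩ := s.2
      -- The channel is frozen, so the belief is exactly 0 or 1: hopeless in the first case,
      -- persistent with `δ = 1` in the second.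
      rw [funext (UpdateSystem.beliefStep_eq_self h0.symm h1) (g := id), Function.iterate_id] at hb
      rcases hb with hb | hb
      · exact UpdateSystem.tendsto_optAvgCost_of_bad h0.symm lam s (Or.inr (hb.trans h0.symm))
      · refine UpdateSystem.tendsto_optAvgCost_of_persistent (UpdateSystem.persistent_one h1) lam s
          (hb.trans h1).ge
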